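/- Let $q$ be an indeterminate. Put $[m]=1+q+\cdots+q^{m-1}$, let $(a;q)_0=1$ and $(a;q)_k=(1-a)(1-aq)\cdots(1-aq^{k-1})$ for $k\geq 1$, and let $\Phi_n(q)$ be the $n$-th cyclotomic polynomial. For rational functions $A(q),B(q)\in\mathbb{Q}(q)$ and a polynomial $P(q)\in\mathbb{Q}[q]$, write $A(q)\equiv B(q)\pmod{P(q)}$ if the numerator of $A(q)-B(q)$, written in lowest terms, is divisible by $P(q)$ in $\mathbb{Q}[q]$. Let $n$ be a positive odd integer, and for $k\geq 0$ let $$c_q(k)=(-1)^k[4k+1]\frac{(q;q^2)_k^4\,(q^2;q^4)_k}{(q^2;q^2)_k^4\,(q^4;q^4)_k}\,q^k.$$ Then, modulo $[n]\Phi_n(q)^2$, $$\sum_{k=0}^{n-1}\sum_{j=0}^{k}c_q(j)\,c_q(k-j)\equiv\begin{cases}[n]^2\,\dfrac{(q^2;q^4)_{(n-1)/4}^4}{(q^4;q^4)_{(n-1)/4}^4}&\text{if } n\equiv 1\pmod 4,\\[10pt] 0&\text{if } n\equiv 3\pmod 4.\end{cases}$$ -/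

import Mathlib

/-- The `q`-shifted factorial `(a; q)_k = (1 - a) (1 - a q) ⋯ (1 - a q ^ (k - 1))`. -/
def qShifted {R : Type*} [CommRing R] (a q : R) (k : ℕ) : R :=
  ∏ i ∈ Finset.range k, (1 - a * q ^ i)

/-- The `q`-integer `[n] = 1 + q + ⋯ + q ^ (n - 1)`. -/
def qInteger {R : Type*} [CommRing R] (q : R) (n : ℕ) : R :=
  ∑ i ∈ Finset.range n, q ^ i

/-- Congruence of rational functions modulo a polynomial `P`: the numerator of `A - B`, written
in lowest terms, is divisible by `P` (so its denominator is coprime to `P`). -/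
def RatFuncCongr (P : Polynomial ℚ) (A B : RatFunc ℚ) : Prop :=
  P ∣ (A - B).num

/-- The term `c_q(k)`, a rational function of the indeterminate `q`. -/
noncomputable def cTerm (k : ℕ) : RatFunc ℚ :=
  let q : RatFunc ℚ := RatFunc.X
  (-1) ^ k * qInteger q (4 * k + 1) *
    (qShifted q (q ^ 2) k ^ 4 * qShifted (q ^ 2) (q ^ 4) k /
      (qShifted (q ^ 2) (q ^ 2) k ^ 4 * qShifted (q ^ 4) (q ^ 4) k)) * q ^ k

/-! The term `cTerm` is the value at x = 1 of a family `wellPoisedTerm` symmetric under x ↔ 1/x.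
Hence, for k < d, moving the parameter from 1 to q^d changes a term only by a multiple of (1 -
q^d)^2, so not at all modulo Φ_d^2. At x = q^n with n odd the series stops after k = (n-1)/2 and has
a closed value V (`terminatingValue`): creative telescoping links the parameters x and q^4 x, that
is n and n + 4 (`sum_wellPoisedTerm_contiguous`), and n = 1 and n = 3 start the two residue classes.

Modulo Φ_n^3: let A be the sum of c_q(k) over k ≤ (n-1)/2. Terms with n/2 < k < n vanish, so the
truncated Cauchy square is A^2. Since A ≡ V modulo Φ_n^2 and Φ_n divides both, A^2 - V^2 = (A - V)(A
+ V) is divisible by Φ_n^3 (`locDvd_truncatedSquare_sub`).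

Modulo Φ_d, for every divisor d > 1 of n, both sides vanish: V contains [n], and on the left a
Lucas-type congruence c_q(ud + r) ≡ c_q(ud) c_q(r) reduces everything to one period
(`locDvd_truncatedSquare`). As [n] is the product of these coprime Φ_d, the congruences combine. For
k ≥ d the written denominators contain Φ_d, so the argument runs in the localization at Φ_d
(`LocDvd`). -/

/-- The ratio of consecutive terms of the very-well-poised series, at `y = q ^ (2 * k)`. -/
def wellPoisedRatio {F : Type*} [Field F] (q x y : F) : F :=
  -q * ((1 - q * y * x) * (x - q * y) * (1 - q * y) ^ 2 * (1 - q ^ 2 * y ^ 2)) /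
    ((1 - q ^ 2 * y * x) * (x - q ^ 2 * y) * (1 - q ^ 2 * y) ^ 2 * (1 - q ^ 4 * y ^ 2))

/-- The very-well-poised term with parameter `x`, without its factor `[4 * k + 1]`. -/
def wellPoisedWeight {F : Type*} [Field F] (q x : F) (k : ℕ) : F :=
  ∏ i ∈ Finset.range k, wellPoisedRatio q x ((q ^ i) ^ 2)

/-- The very-well-poised term with parameter `x`; `x = 1` gives `cTerm`. -/
def wellPoisedTerm {F : Type*} [Field F] (q x : F) (k : ℕ) : F :=
  qInteger q (4 * k + 1) * wellPoisedWeight q x k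

/-- The ratio of consecutive values of `certWeight`, at `y = q ^ (2 * k)`. -/
def certRatio {F : Type*} [Field F] (q x y : F) : F :=
  -q * ((1 - x * q * y) * (x * q ^ 3 - y) * (1 - q * y) ^ 2 * (1 - q ^ 2 * y ^ 2)) /
    (q ^ 3 * (x - q ^ 2 * y) * (1 - x * q ^ 6 * y) * (1 - q ^ 2 * y) ^ 2 * (1 - q ^ 4 * y ^ 2))

/-- The common hypergeometric part of the terms with parameters `x` and `q ^ 4 * x`. -/
def certWeight {F : Type*} [Field F] (q x : F) (k : ℕ) : F :=
  ∏ i ∈ Finset.range k, certRatio q x ((q ^ i) ^ 2)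

/-- The polynomial factor of the Wilf–Zeilberger certificate. -/
def certFactor {F : Type*} [Field F] (q x y : F) : F :=
  q ^ 2 * x * (1 + q ^ 2 * x) * ((1 - y) ^ 2 * (1 - y ^ 2) * (x - y) * (1 - x * y * q ^ 4)) /
    ((1 - x * q) * (x * q ^ 3 - 1))

/-! ### Creative telescoping for the terminating series. -/

section Evaluation

variable {F : Type*} [Field F] {q : F}

theorem qInteger_eq_div (h : q ≠ 1) (n : ℕ) : qInteger q n = (1 - q ^ n) / (1 - q) := by
  rw [qInteger, geom_sum_eq h, ← neg_sub, ← neg_sub (1 : F) q, neg_div_neg_eq]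

theorem pow_ne_pow_of_forall_ne_one (hq : ∀ m, 0 < m → q ^ m ≠ 1) (h0 : q ≠ 0) {a b : ℕ}
    (hab : a ≠ b) : q ^ a ≠ q ^ b := by
  intro h
  rcases lt_or_gt_of_ne hab with h1 | h1
  · obtain ⟨c, rfl⟩ := Nat.exists_eq_add_of_lt h1
    rw [add_assoc, pow_add] at h
    exact hq (c + 1) (by omega) (by simpa [h0] using h.symm)
  · obtain ⟨c, rfl⟩ := Nat.exists_eq_add_of_lt h1
    rw [add_assoc, pow_add] at h
    exact hq (c + 1) (by omega) (by simpa [h0] using h)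

theorem wellPoisedWeight_eq_zero {n k : ℕ} (hk : n < 2 * k) (hn : Odd n) :
    wellPoisedWeight q (q ^ n) k = 0 := by
  obtain ⟨m, rfl⟩ := hn
  refine Finset.prod_eq_zero (i := m) (Finset.mem_range.2 (by omega)) ?_
  have : q ^ (2 * m + 1) - q * (q ^ m) ^ 2 = 0 := by ring
  simp [wellPoisedRatio, this]

theorem certWeight_eq_zero {n k : ℕ} (hk : n + 3 < 2 * k) (hn : Odd n) :
    certWeight q (q ^ n) k = 0 := by
  obtain ⟨m, rfl⟩ := hn
  refine Finset.prod_eq_zero (i := m + 2) (Finset.mem_range.2 (by omega)) ?_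
  have : q ^ (2 * m + 1) * q ^ 3 - (q ^ (m + 2)) ^ 2 = 0 := by ring
  simp [certRatio, this]

/-- `certWeight` keeps only the numerator factors common to the weights at x and q^4 x, and all
denominator factors of either. Each weight is therefore `certWeight` times a polynomial in y =
q^(2k), normalised by its value at y = 1. -/
theorem wellPoisedWeight_eq_certWeight (h0 : q ≠ 0) {x : F}
    (h1 : x * q ^ 3 - 1 ≠ 0) (h2 : x * q - 1 ≠ 0) (h3 : 1 - x * q ^ 2 ≠ 0) (h4 : 1 - x * q ^ 4 ≠ 0)
    (hd : ∀ k : ℕ, 1 - q ^ 2 * (q ^ k) ^ 2 * x ≠ 0)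
    (he : ∀ k : ℕ, x - q ^ 2 * (q ^ k) ^ 2 ≠ 0)
    (hf : ∀ k : ℕ, 1 - q ^ 2 * (q ^ k) ^ 2 ≠ 0)
    (hg : ∀ k : ℕ, 1 - q ^ 4 * ((q ^ k) ^ 2) ^ 2 ≠ 0)
    (hh : ∀ k : ℕ, 1 - x * q ^ 6 * (q ^ k) ^ 2 ≠ 0) (k : ℕ) :
    wellPoisedWeight q x k =
      (x * q ^ 3 - (q ^ k) ^ 2) * (x * q - (q ^ k) ^ 2) * (1 - x * q ^ 2 * (q ^ k) ^ 2) *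
        (1 - x * q ^ 4 * (q ^ k) ^ 2) /
      ((x * q ^ 3 - 1) * (x * q - 1) * (1 - x * q ^ 2) * (1 - x * q ^ 4)) * certWeight q x k := by
  induction k with
  | zero => simp [wellPoisedWeight, certWeight]; field_simp
  | succ k ih =>
    rw [wellPoisedWeight, Finset.prod_range_succ, ← wellPoisedWeight, ih, certWeight, certWeight,
      Finset.prod_range_succ]
    generalize ∏ i ∈ Finset.range k, certRatio q x ((q ^ i) ^ 2) = b
    have hd := hd k
    have he := he k
    have hf := hf k
    have hg := hg k
    have hh := hh k
    have hy : (q ^ (k + 1)) ^ 2 = q ^ 2 * (q ^ k) ^ 2 := by ring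
    rw [hy]
    generalize (q ^ k) ^ 2 = y at *
    have hcross : (x * q ^ 3 - y) * (x * q - y) * (1 - x * q ^ 2 * y) * (1 - x * q ^ 4 * y) *
          wellPoisedRatio q x y =
        (x * q ^ 3 - q ^ 2 * y) * (x * q - q ^ 2 * y) * (1 - x * q ^ 2 * (q ^ 2 * y)) *
          (1 - x * q ^ 4 * (q ^ 2 * y)) * certRatio q x y := by
      rw [wellPoisedRatio, certRatio, mul_div_assoc', mul_div_assoc',
        div_eq_div_iff (by simp [*]) (by simp [*])]
      ring
    rw [div_mul_eq_mul_div, div_mul_eq_mul_div, div_mul_eq_mul_div]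
    congr 1
    linear_combination b * hcross

theorem wellPoisedWeight_shift_eq_certWeight (h0 : q ≠ 0) {x : F}
    (h1 : 1 - x * q ≠ 0) (h2 : 1 - x * q ^ 3 ≠ 0) (h3 : x * q ^ 2 - 1 ≠ 0) (h4 : x - 1 ≠ 0)
    (he : ∀ k : ℕ, x - q ^ 2 * (q ^ k) ^ 2 ≠ 0)
    (hd : ∀ k : ℕ, q ^ 4 * x - q ^ 2 * (q ^ k) ^ 2 ≠ 0)
    (hf : ∀ k : ℕ, 1 - q ^ 2 * (q ^ k) ^ 2 ≠ 0)
    (hg : ∀ k : ℕ, 1 - q ^ 4 * ((q ^ k) ^ 2) ^ 2 ≠ 0)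
    (hh : ∀ k : ℕ, 1 - x * q ^ 6 * (q ^ k) ^ 2 ≠ 0) (k : ℕ) :
    wellPoisedWeight q (q ^ 4 * x) k =
      (1 - x * q * (q ^ k) ^ 2) * (1 - x * q ^ 3 * (q ^ k) ^ 2) * (x * q ^ 2 - (q ^ k) ^ 2) *
        (x - (q ^ k) ^ 2) /
      ((1 - x * q) * (1 - x * q ^ 3) * (x * q ^ 2 - 1) * (x - 1)) * certWeight q x k := by
  induction k with
  | zero => simp [wellPoisedWeight, certWeight]; field_simp
  | succ k ih =>
    rw [wellPoisedWeight, Finset.prod_range_succ, ← wellPoisedWeight, ih, certWeight, certWeight,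
      Finset.prod_range_succ]
    generalize ∏ i ∈ Finset.range k, certRatio q x ((q ^ i) ^ 2) = b
    have hd := hd k
    have he := he k
    have hf := hf k
    have hg := hg k
    have hh := hh k
    have hi : 1 - q ^ 2 * (q ^ k) ^ 2 * (q ^ 4 * x) ≠ 0 := by
      convert hh using 1; ring
    have hy : (q ^ (k + 1)) ^ 2 = q ^ 2 * (q ^ k) ^ 2 := by ring
    rw [hy]
    generalize (q ^ k) ^ 2 = y at *
    have hcross : (1 - x * q * y) * (1 - x * q ^ 3 * y) * (x * q ^ 2 - y) * (x - y) *
          wellPoisedRatio q (q ^ 4 * x) y =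
        (1 - x * q * (q ^ 2 * y)) * (1 - x * q ^ 3 * (q ^ 2 * y)) * (x * q ^ 2 - q ^ 2 * y) *
          (x - q ^ 2 * y) * certRatio q x y := by
      rw [wellPoisedRatio, certRatio, mul_div_assoc', mul_div_assoc',
        div_eq_div_iff (by simp [*]) (by simp [*])]
      ring
    rw [div_mul_eq_mul_div, div_mul_eq_mul_div, div_mul_eq_mul_div]
    congr 1
    linear_combination b * hcross

/-- The combination of the two summands is a difference G(k+1) - G(k), with G on the right-hand
side. There is no lower boundary term because `certFactor` vanishes at y = 1. -/
theorem sum_wellPoisedTerm_contiguous (hq : ∀ m, 0 < m → q ^ m ≠ 1) (h0 : q ≠ 0) {n : ℕ}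
    (hn : Odd n) (K : ℕ) :
    (1 - q ^ n) * (1 - q ^ n * q ^ 3) ^ 2 *
        ∑ k ∈ Finset.range K, wellPoisedTerm q (q ^ 4 * q ^ n) k -
      (1 - q ^ n * q ^ 4) * (1 - q ^ n * q) ^ 2 *
        ∑ k ∈ Finset.range K, wellPoisedTerm q (q ^ n) k =
      certFactor q (q ^ n) ((q ^ K) ^ 2) * certWeight q (q ^ n) K := by
  have hn0 : 0 < n := hn.pos
  have hne : ∀ a b : ℕ, a ≠ b → q ^ a - q ^ b ≠ 0 := fun a b h =>
    sub_ne_zero.2 (pow_ne_pow_of_forall_ne_one hq h0 h)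
  have g1 : ∀ m, 0 < m → 1 - q ^ m ≠ 0 := fun m hm => sub_ne_zero.2 (hq m hm).symm
  have e1 : q ^ n * q - 1 ≠ 0 := by simpa [pow_succ] using hne (n + 1) 0 (by omega)
  have e3 : q ^ n * q ^ 3 - 1 ≠ 0 := by simpa [pow_add] using hne (n + 3) 0 (by omega)
  have e2 : q ^ n * q ^ 2 - 1 ≠ 0 := by simpa [pow_add] using hne (n + 2) 0 (by omega)
  have e4 : 1 - q ^ n * q ^ 4 ≠ 0 := by simpa [pow_add] using hne 0 (n + 4) (by omega)
  have e2' : 1 - q ^ n * q ^ 2 ≠ 0 := by simpa [pow_add] using hne 0 (n + 2) (by omega)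
  have e1' : 1 - q ^ n * q ≠ 0 := by simpa [pow_add] using hne 0 (n + 1) (by omega)
  have e3' : 1 - q ^ n * q ^ 3 ≠ 0 := by simpa [pow_add] using hne 0 (n + 3) (by omega)
  have e0 : q ^ n - 1 ≠ 0 := by simpa [pow_add] using hne n 0 (by omega)
  have hd : ∀ k : ℕ, 1 - q ^ 2 * (q ^ k) ^ 2 * q ^ n ≠ 0 := fun k => by
    convert g1 (2 + k * 2 + n) (by omega) using 2; ring
  -- Oddness of n keeps the factor x - q^2 y of the denominator away from zero.
  have he : ∀ k : ℕ, q ^ n - q ^ 2 * (q ^ k) ^ 2 ≠ 0 := fun k => by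
    convert hne n (2 + k * 2) (by rintro rfl; revert hn; simp [parity_simps]) using 2; ring
  have he' : ∀ k : ℕ, q ^ 4 * q ^ n - q ^ 2 * (q ^ k) ^ 2 ≠ 0 := fun k => by
    convert hne (4 + n) (2 + k * 2) (by rcases hn with ⟨m, rfl⟩; omega) using 2 <;> ring
  have hf : ∀ k : ℕ, 1 - q ^ 2 * (q ^ k) ^ 2 ≠ 0 := fun k => by
    convert g1 (2 + k * 2) (by omega) using 2; ring
  have hg : ∀ k : ℕ, 1 - q ^ 4 * ((q ^ k) ^ 2) ^ 2 ≠ 0 := fun k => by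
    convert g1 (4 + k * 2 * 2) (by omega) using 2; ring
  have hh : ∀ k : ℕ, 1 - q ^ n * q ^ 6 * (q ^ k) ^ 2 ≠ 0 := fun k => by
    convert g1 (n + 6 + k * 2) (by omega) using 2; ring
  have hx : q ^ n ≠ 0 := pow_ne_zero _ h0
  have hq1 : q ≠ 1 := by simpa using hq 1 one_pos
  have hq1' : 1 - q ≠ 0 := sub_ne_zero.2 hq1.symm
  induction K with
  | zero => simp [certFactor]
  | succ k ih =>
    rw [Finset.sum_range_succ, Finset.sum_range_succ, mul_add, mul_add, add_sub_add_comm, ih,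
      wellPoisedTerm, wellPoisedTerm, qInteger_eq_div hq1,
      wellPoisedWeight_eq_certWeight h0 e3 e1 e2' e4 hd he hf hg hh,
      wellPoisedWeight_shift_eq_certWeight h0 e1' e3' e2 e0 he he' hf hg hh,
      certWeight, certWeight, Finset.prod_range_succ]
    generalize ∏ i ∈ Finset.range k, certRatio q (q ^ n) ((q ^ i) ^ 2) = b
    have he := he k
    have hf := hf k
    have hg := hg k
    have hh := hh k
    have hy : (q ^ (k + 1)) ^ 2 = q ^ 2 * (q ^ k) ^ 2 := by ring
    have hz : q ^ (4 * k + 1) = q * ((q ^ k) ^ 2) ^ 2 := by ring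
    rw [hy, hz]
    clear hne hq hd he' hn ih hy hz
    generalize (q ^ k) ^ 2 = y at *
    generalize q ^ n = x at *
    -- At q^2 y the y-dependent factors of `certFactor` are exactly those in the denominator of
    -- `certRatio`.
    have h1 : certFactor q x (q ^ 2 * y) * certRatio q x y =
        -(x * (1 + q ^ 2 * x) * ((1 - x * q * y) * (x * q ^ 3 - y) * (1 - q * y) ^ 2 *
          (1 - q ^ 2 * y ^ 2))) / ((1 - x * q) * (x * q ^ 3 - 1)) := by
      rw [certFactor, certRatio, div_mul_div_comm, div_eq_div_iff (by simp [*]) (by simp [*])]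
      ring
    have h2 : (1 - x) * (1 - x * q ^ 3) ^ 2 *
        ((1 - x * q * y) * (1 - x * q ^ 3 * y) * (x * q ^ 2 - y) * (x - y) /
          ((1 - x * q) * (1 - x * q ^ 3) * (x * q ^ 2 - 1) * (x - 1))) =
        -((1 - x * q ^ 3) * ((1 - x * q * y) * (1 - x * q ^ 3 * y) * (x * q ^ 2 - y) * (x - y))) /
          ((1 - x * q) * (x * q ^ 2 - 1)) := by
      rw [mul_div_assoc', div_eq_div_iff (by simp [*]) (by simp [*])]
      ring
    have h3 : (1 - x * q ^ 4) * (1 - x * q) ^ 2 *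
        ((x * q ^ 3 - y) * (x * q - y) * (1 - x * q ^ 2 * y) * (1 - x * q ^ 4 * y) /
          ((x * q ^ 3 - 1) * (x * q - 1) * (1 - x * q ^ 2) * (1 - x * q ^ 4))) =
        (1 - x * q) * ((x * q ^ 3 - y) * (x * q - y) * (1 - x * q ^ 2 * y) *
          (1 - x * q ^ 4 * y)) / ((x * q ^ 3 - 1) * (x * q ^ 2 - 1)) := by
      rw [mul_div_assoc', div_eq_div_iff (by simp [*]) (by simp [*])]
      ring
    have h4 : certFactor q x (q ^ 2 * y) * (b * certRatio q x y) =
        certFactor q x (q ^ 2 * y) * certRatio q x y * b := by ring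
    have h5 : ∀ A B s t u : F, A * ((1 - q * y ^ 2) / (1 - q) * (s * b)) -
        B * ((1 - q * y ^ 2) / (1 - q) * (t * b)) =
        (A * s - B * t) * ((1 - q * y ^ 2) / (1 - q)) * b := by intros; ring
    rw [h4, h1, h5 _ _ _ _ 1, h2, h3, certFactor]
    -- The telescoping relation with denominators cleared: a polynomial identity in q, x and y.
    have hkey : ((x * q ^ 3 - 1) ^ 2 *
          ((1 - x * q * y) * (1 - x * q ^ 3 * y) * (x * q ^ 2 - y) * (x - y)) -
        (1 - x * q) ^ 2 * ((x * q ^ 3 - y) * (x * q - y) * (1 - x * q ^ 2 * y) *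
          (1 - x * q ^ 4 * y))) * (1 - q * y ^ 2) +
        x * (1 + q ^ 2 * x) * (x * q ^ 2 - 1) * (1 - q) *
          (q ^ 2 * ((1 - y) ^ 2 * (1 - y ^ 2) * (x - y) * (1 - x * y * q ^ 4)) +
          (1 - x * q * y) * (x * q ^ 3 - y) * (1 - q * y) ^ 2 * (1 - q ^ 2 * y ^ 2)) = 0 := by
      ring
    have hneg : 1 - x * q ^ 3 = -(x * q ^ 3 - 1) := by ring
    rw [hneg] at *
    clear h1 h2 h3 h4 h5 he hf hg hh e0 e4 hneg
    -- The long products become atoms, since `hkey` already holds all the algebra between them.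
    generalize (1 - x * q * y) * (1 - x * q ^ 3 * y) * (x * q ^ 2 - y) * (x - y) = U at *
    generalize (x * q ^ 3 - y) * (x * q - y) * (1 - x * q ^ 2 * y) * (1 - x * q ^ 4 * y) = V at *
    generalize (1 - y) ^ 2 * (1 - y ^ 2) * (x - y) * (1 - x * y * q ^ 4) = M at *
    generalize (1 - x * q * y) * (x * q ^ 3 - y) * (1 - q * y) ^ 2 * (1 - q ^ 2 * y ^ 2) = N at *
    generalize x * q ^ 3 - 1 = c at *
    generalize 1 - x * q = d at *
    generalize x * q ^ 2 - 1 = e at *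
    generalize 1 + q ^ 2 * x = r at *
    generalize 1 - q = f at *
    field_simp
    linear_combination b * hkey

end Evaluation

/-! ### Closed form of the terminating series, and its link with `cTerm`. -/

section Evaluation

variable {F : Type*} [Field F] {q : F}

/-- The bound on K makes `certWeight` vanish at K, so the upper boundary term disappears and a
recurrence in n remains. -/
theorem sum_wellPoisedTerm_step (hq : ∀ m, 0 < m → q ^ m ≠ 1) (h0 : q ≠ 0) {n K : ℕ}
    (hn : Odd n) (hK : n + 3 < 2 * K) :
    ∑ k ∈ Finset.range K, wellPoisedTerm q (q ^ (n + 4)) k =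
      (1 - q ^ (n + 4)) * (1 - q ^ (n + 1)) ^ 2 / ((1 - q ^ n) * (1 - q ^ (n + 3)) ^ 2) *
        ∑ k ∈ Finset.range K, wellPoisedTerm q (q ^ n) k := by
  have h := sum_wellPoisedTerm_contiguous hq h0 hn K
  rw [certWeight_eq_zero hK hn, mul_zero, sub_eq_zero] at h
  have h1 : 1 - q ^ n ≠ 0 := sub_ne_zero.2 (hq _ hn.pos).symm
  have h2 : 1 - q ^ (n + 3) ≠ 0 := sub_ne_zero.2 (hq _ (by omega)).symm
  have h3 : q ^ (n + 4) = q ^ 4 * q ^ n := by ring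
  rw [div_mul_eq_mul_div, eq_div_iff (by simp [*]), h3]
  linear_combination h

theorem sum_wellPoisedTerm_one_mod_four (hq : ∀ m, 0 < m → q ^ m ≠ 1) (h0 : q ≠ 0) (m : ℕ) :
    ∀ K, 2 * m + 1 ≤ K → ∑ k ∈ Finset.range K, wellPoisedTerm q (q ^ (4 * m + 1)) k =
      qInteger q (4 * m + 1) * (qShifted (q ^ 2) (q ^ 4) m / qShifted (q ^ 4) (q ^ 4) m) ^ 2 := by
  have hq1 : q ≠ 1 := by simpa using hq 1 one_pos
  induction m with
  | zero =>
    intro K hK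
    rw [Finset.sum_eq_single_of_mem 0 (Finset.mem_range.2 hK)]
    · simp [wellPoisedTerm, wellPoisedWeight, qShifted]
    · intro k _ hk
      rw [wellPoisedTerm, wellPoisedWeight_eq_zero (by omega) (by simp), mul_zero]
  | succ m ih =>
    intro K hK
    have h1 : 1 - q ^ (4 * m + 1) ≠ 0 := sub_ne_zero.2 (hq _ (by omega)).symm
    have h2 : 1 - q ^ (4 * m + 4) ≠ 0 := sub_ne_zero.2 (hq _ (by omega)).symm
    have h3 : 1 - q ≠ 0 := sub_ne_zero.2 hq1.symm
    have e1 : q ^ 2 * (q ^ 4) ^ m = q ^ (4 * m + 1 + 1) := by ring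
    have e2 : q ^ 4 * (q ^ 4) ^ m = q ^ (4 * m + 4) := by ring
    rw [show 4 * (m + 1) + 1 = 4 * m + 1 + 4 by ring,
      sum_wellPoisedTerm_step hq h0 ⟨2 * m, by ring⟩ (by omega), ih K (by omega),
      qShifted, qShifted, qShifted, qShifted, Finset.prod_range_succ, Finset.prod_range_succ,
      e1, e2, qInteger_eq_div hq1, qInteger_eq_div hq1, mul_div_mul_comm (∏ _ ∈ _, _),
      show 4 * m + 1 + 3 = 4 * m + 4 by ring]
    generalize (∏ x ∈ Finset.range m, (1 - q ^ 2 * (q ^ 4) ^ x)) /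
      ∏ x ∈ Finset.range m, (1 - q ^ 4 * (q ^ 4) ^ x) = g
    field_simp

/-- For n = 3 only k = 0 and k = 1 survive, and they cancel; the recurrence carries the zero along.
-/
theorem sum_wellPoisedTerm_three_mod_four (hq : ∀ m, 0 < m → q ^ m ≠ 1) (h0 : q ≠ 0) (m : ℕ) :
    ∀ K, 2 * m + 2 ≤ K → ∑ k ∈ Finset.range K, wellPoisedTerm q (q ^ (4 * m + 3)) k = 0 := by
  have hq1 : q ≠ 1 := by simpa using hq 1 one_pos
  induction m with
  | zero =>
    intro K hK
    rw [← Finset.sum_subset (s₁ := Finset.range 2) (by simpa using hK)]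
    · have h1 : 1 - q ≠ 0 := sub_ne_zero.2 hq1.symm
      have h2 : 1 + q ≠ 0 := fun h => hq 2 (by norm_num) (by linear_combination (q - 1) * h)
      have h4 : 1 - q ^ 4 ≠ 0 := sub_ne_zero.2 (hq 4 (by norm_num)).symm
      have h5 : 1 - q ^ 5 ≠ 0 := sub_ne_zero.2 (hq 5 (by norm_num)).symm
      have e2 : 1 - q ^ 2 = (1 - q) * (1 + q) := by ring
      have e3 : q ^ 3 - q ^ 2 = -(q ^ 2 * (1 - q)) := by ring
      have e4 : q ^ 3 - q = -(q * ((1 - q) * (1 + q))) := by ring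
      have e5 : 1 - q ^ 2 * q ^ 3 = 1 - q ^ 5 := by ring
      have e6 : 1 - q * q ^ 3 = 1 - q ^ 4 := by ring
      simp only [Finset.sum_range_succ, Finset.sum_range_zero, wellPoisedTerm, wellPoisedWeight,
        Finset.prod_range_succ, Finset.prod_range_zero, wellPoisedRatio, qInteger_eq_div hq1,
        mul_zero, zero_add, pow_zero, pow_one, mul_one, one_mul, one_pow, e2, e3, e4, e5, e6]
      norm_num
      field_simp
      ring
    · intro k _ hk
      have h2k : 2 ≤ k := not_lt.1 (mt Finset.mem_range.2 hk)
      rw [wellPoisedTerm, wellPoisedWeight_eq_zero (by omega) (by decide), mul_zero]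
  | succ m ih =>
    intro K hK
    rw [show 4 * (m + 1) + 3 = 4 * m + 3 + 4 by ring,
      sum_wellPoisedTerm_step hq h0 ⟨2 * m + 1, by ring⟩ (by omega), ih K (by omega), mul_zero]

/-- The term with parameter `1` in terms of shifted factorials. -/
theorem wellPoisedWeight_one (k : ℕ) :
    wellPoisedWeight q 1 k = (-1) ^ k *
      ((qShifted q (q ^ 2) k / qShifted (q ^ 2) (q ^ 2) k) ^ 4 *
        (qShifted (q ^ 2) (q ^ 4) k / qShifted (q ^ 4) (q ^ 4) k)) * q ^ k := by
  induction k with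
  | zero => simp [wellPoisedWeight, qShifted]
  | succ k ih =>
    rw [wellPoisedWeight, Finset.prod_range_succ, ← wellPoisedWeight, ih, wellPoisedRatio]
    simp only [qShifted, Finset.prod_range_succ]
    generalize ∏ x ∈ Finset.range k, (1 - q ^ 2 * (q ^ 2) ^ x) = a
    generalize ∏ x ∈ Finset.range k, (1 - q * (q ^ 2) ^ x) = b
    generalize ∏ x ∈ Finset.range k, (1 - q ^ 2 * (q ^ 4) ^ x) = c
    generalize ∏ x ∈ Finset.range k, (1 - q ^ 4 * (q ^ 4) ^ x) = d
    have e1 : (q ^ 2) ^ k = (q ^ k) ^ 2 := by ring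
    have e2 : (q ^ 4) ^ k = ((q ^ k) ^ 2) ^ 2 := by ring
    rw [e1, e2, pow_succ q k]
    generalize q ^ k = z
    rw [mul_one, mul_one]
    generalize 1 - q ^ 2 * z ^ 2 = s
    generalize 1 - q ^ 4 * (z ^ 2) ^ 2 = t
    ring

end Evaluation

theorem cTerm_eq_wellPoisedTerm (k : ℕ) : cTerm k = wellPoisedTerm RatFunc.X 1 k := by
  rw [wellPoisedTerm, wellPoisedWeight_one, cTerm]
  simp only [div_pow, div_mul_div_comm]
  ring

/-! ### Gaussian binomial coefficients and integrality. -/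

section QBinomial

variable {R : Type*} [CommRing R]

/-- The product of two shifted factorials `(p; p)_m`, `(p; p)_n` divides `(p; p)_{m + n}`. -/
theorem qShifted_mul_dvd_qShifted_add (p : R) (m n : ℕ) :
    qShifted p p m * qShifted p p n ∣ qShifted p p (m + n) := by
  have key : ∀ s m n, m + n = s → qShifted p p m * qShifted p p n ∣ qShifted p p (m + n) := by
    intro s
    induction s with
    | zero =>
      intro m n h
      obtain ⟨rfl, rfl⟩ : m = 0 ∧ n = 0 := by omega
      simp [qShifted]
    | succ s ih =>
      intro m n h
      rcases m with _ | m
      · simp [qShifted]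
      rcases n with _ | n
      · simp [qShifted]
      obtain ⟨a, ha⟩ := ih m (n + 1) (by omega)
      obtain ⟨b, hb⟩ := ih (m + 1) n (by omega)
      have hm : qShifted p p (m + 1) = qShifted p p m * (1 - p * p ^ m) :=
        Finset.prod_range_succ _ _
      have hn : qShifted p p (n + 1) = qShifted p p n * (1 - p * p ^ n) :=
        Finset.prod_range_succ _ _
      have hs : qShifted p p (m + 1 + (n + 1)) =
          qShifted p p (m + (n + 1)) * (1 - p * p ^ (m + (n + 1))) := by
        rw [show m + 1 + (n + 1) = m + (n + 1) + 1 by ring]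
        exact Finset.prod_range_succ _ _
      have he : m + 1 + n = m + (n + 1) := by ring
      rw [he] at hb
      refine ⟨a + p * p ^ m * b, ?_⟩
      -- The q-Pascal rule.
      have h1 : 1 - p * p ^ (m + (n + 1)) =
          (1 - p * p ^ m) + p * p ^ m * (1 - p * p ^ n) := by ring
      rw [hs, h1, mul_add]
      nth_rewrite 1 [ha]
      rw [hb, hm, hn]
      ring
  exact key _ m n rfl

theorem qShifted_two_mul (p : R) (k : ℕ) :
    qShifted p p (k + k) = qShifted p (p ^ 2) k * qShifted (p ^ 2) (p ^ 2) k := by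
  induction k with
  | zero => simp [qShifted]
  | succ k ih =>
    rw [show k + 1 + (k + 1) = k + k + 1 + 1 by ring]
    simp only [qShifted, Finset.prod_range_succ] at *
    rw [ih]
    ring

theorem qShifted_sq (p : R) (k : ℕ) :
    qShifted (p ^ 2) (p ^ 2) k = qShifted p p k * qShifted (-p) p k := by
  simp only [qShifted, ← Finset.prod_mul_distrib]
  refine Finset.prod_congr rfl fun i _ => ?_
  ring

/-- With b the Gaussian binomial of 2k over k, this rewrites (p;p^2)_k / (p^2;p^2)_k as b /
(-p;p)_k^2, a denominator that Φ_d does not meet for odd d > 1 when p is a power of the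
indeterminate. -/
theorem exists_qShifted_mul_sq_eq [IsDomain R] {p : R} (hp : ∀ m, 0 < m → p ^ m ≠ 1) (k : ℕ) :
    ∃ b, qShifted p (p ^ 2) k * qShifted (-p) p k ^ 2 = b * qShifted (p ^ 2) (p ^ 2) k := by
  obtain ⟨b, hb⟩ := qShifted_mul_dvd_qShifted_add p k k
  refine ⟨b, ?_⟩
  have h0 : qShifted (p ^ 2) (p ^ 2) k ≠ 0 := by
    refine Finset.prod_ne_zero_iff.2 fun i _ => sub_ne_zero.2 ?_
    convert (hp (2 + 2 * i) (by omega)).symm using 1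
    ring
  refine mul_right_cancel₀ h0 ?_
  rw [qShifted_two_mul] at hb
  rw [mul_right_comm, hb, qShifted_sq]
  ring

end QBinomial

/-! ### Divisibility in the localization at a prime polynomial. -/

open Polynomial in
/-- `f` is divisible by `P ^ e` in the localization of `ℚ[X]` at the prime `P`. -/
def LocDvd (P : ℚ[X]) (e : ℕ) (f : RatFunc ℚ) : Prop :=
  ∃ a b : ℚ[X], ¬ P ∣ b ∧
    f * algebraMap ℚ[X] (RatFunc ℚ) b = algebraMap ℚ[X] (RatFunc ℚ) (P ^ e * a)

namespace LocDvd

open Polynomial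

variable {P : ℚ[X]} {e e' : ℕ} {f g : RatFunc ℚ}

theorem of_dvd (hP : Prime P) {a : ℚ[X]} (h : P ^ e ∣ a) :
    LocDvd P e (algebraMap ℚ[X] (RatFunc ℚ) a) := by
  obtain ⟨c, rfl⟩ := h
  exact ⟨c, 1, fun h => hP.not_isUnit (isUnit_of_dvd_one h), by simp⟩

theorem polynomial (hP : Prime P) (a : ℚ[X]) : LocDvd P 0 (algebraMap ℚ[X] (RatFunc ℚ) a) :=
  of_dvd hP (by simp)

theorem zero (hP : Prime P) : LocDvd P e 0 := by
  simpa using of_dvd hP (e := e) (dvd_zero _)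

theorem add (hP : Prime P) (hf : LocDvd P e f) (hg : LocDvd P e g) : LocDvd P e (f + g) := by
  obtain ⟨a, b, hb, h⟩ := hf
  obtain ⟨c, d, hd, h'⟩ := hg
  refine ⟨a * d + c * b, b * d, fun hbd => (hP.dvd_or_dvd hbd).elim hb hd, ?_⟩
  simp only [map_mul, map_add] at *
  linear_combination algebraMap ℚ[X] (RatFunc ℚ) d * h + algebraMap ℚ[X] (RatFunc ℚ) b * h'

theorem mul (hP : Prime P) (hf : LocDvd P e f) (hg : LocDvd P e' g) :
    LocDvd P (e + e') (f * g) := by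
  obtain ⟨a, b, hb, h⟩ := hf
  obtain ⟨c, d, hd, h'⟩ := hg
  refine ⟨a * c, b * d, fun hbd => (hP.dvd_or_dvd hbd).elim hb hd, ?_⟩
  simp only [map_mul, pow_add] at *
  rw [mul_mul_mul_comm, h, h']
  ring

theorem pow (hP : Prime P) (hf : LocDvd P e f) (n : ℕ) : LocDvd P (n * e) (f ^ n) := by
  induction n with
  | zero => simpa using polynomial hP 1
  | succ n ih => rw [pow_succ, Nat.succ_mul]; exact ih.mul hP hf

theorem mono (hf : LocDvd P e f) (h : e' ≤ e) : LocDvd P e' f := by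
  obtain ⟨a, b, hb, h'⟩ := hf
  refine ⟨P ^ (e - e') * a, b, hb, ?_⟩
  rw [h', ← mul_assoc, ← pow_add, Nat.add_sub_cancel' h]

theorem mul_left (hP : Prime P) (hg : LocDvd P 0 g) (hf : LocDvd P e f) : LocDvd P e (g * f) := by
  simpa using hg.mul hP hf

theorem mul_right (hP : Prime P) (hf : LocDvd P e f) (hg : LocDvd P 0 g) : LocDvd P e (f * g) := by
  simpa using hf.mul hP hg

theorem neg (hP : Prime P) (hf : LocDvd P e f) : LocDvd P e (-f) := by
  simpa using mul_left hP (polynomial hP (-1)) hf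

theorem sub (hP : Prime P) (hf : LocDvd P e f) (hg : LocDvd P e g) : LocDvd P e (f - g) := by
  simpa [sub_eq_add_neg] using hf.add hP (hg.neg hP)

theorem sum (hP : Prime P) {ι : Type*} (s : Finset ι) {f : ι → RatFunc ℚ}
    (h : ∀ i ∈ s, LocDvd P e (f i)) : LocDvd P e (∑ i ∈ s, f i) := by
  classical
  induction s using Finset.induction_on with
  | empty => simpa using zero hP
  | insert i s hi ih =>
    rw [Finset.sum_insert hi]
    exact (h i (by simp)).add hP (ih fun j hj => h j (by simp [hj]))

theorem div (hf : LocDvd P e f) (hP : Prime P) {c : ℚ[X]} (hc : ¬ P ∣ c) :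
    LocDvd P e (f / algebraMap ℚ[X] (RatFunc ℚ) c) := by
  obtain ⟨a, b, hb, h⟩ := hf
  have hc0 : algebraMap ℚ[X] (RatFunc ℚ) c ≠ 0 := by
    simp only [ne_eq, FaithfulSMul.algebraMap_eq_zero_iff]
    rintro rfl
    exact hc (dvd_zero _)
  refine ⟨a, b * c, fun hbd => (hP.dvd_or_dvd hbd).elim hb hc, ?_⟩
  rw [← h, map_mul]
  field_simp

/-- Quotients of congruent polynomials are congruent. -/
theorem div_sub_div (hP : Prime P) (he : e ≠ 0) {a a' b b' : ℚ[X]} (ha : P ^ e ∣ a - a')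
    (hb : P ^ e ∣ b - b') (hb' : ¬ P ∣ b') :
    LocDvd P e (algebraMap ℚ[X] (RatFunc ℚ) a / algebraMap ℚ[X] (RatFunc ℚ) b -
      algebraMap ℚ[X] (RatFunc ℚ) a' / algebraMap ℚ[X] (RatFunc ℚ) b') := by
  have hPb : ¬ P ∣ b := fun h => hb' ((dvd_sub_right h).1 ((dvd_pow_self P he).trans hb))
  have h0 : ∀ {c : ℚ[X]}, ¬ P ∣ c → algebraMap ℚ[X] (RatFunc ℚ) c ≠ 0 := by
    intro c hc
    simp only [ne_eq, FaithfulSMul.algebraMap_eq_zero_iff]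
    rintro rfl
    exact hc (dvd_zero _)
  rw [_root_.div_sub_div _ _ (h0 hPb) (h0 hb')]
  simp only [← map_mul, ← map_sub]
  refine div (of_dvd hP ?_) hP fun hbd => (hP.dvd_or_dvd hbd).elim hPb hb'
  have : a * b' - b * a' = (a - a') * b' - (b - b') * a' := by ring
  rw [this]
  exact dvd_sub (ha.mul_right _) (hb.mul_right _)

/-- Congruences modulo `P ^ e` may be multiplied. -/
theorem mul_sub_mul (hP : Prime P) {f' g' : RatFunc ℚ} (hf : LocDvd P e (f - f'))
    (hg : LocDvd P e (g - g')) (hf' : LocDvd P 0 f') (hg0 : LocDvd P 0 g) :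
    LocDvd P e (f * g - f' * g') := by
  have : f * g - f' * g' = (f - f') * g + f' * (g - g') := by ring
  rw [this]
  exact (mul_right hP hf hg0).add hP (mul_left hP hf' hg)

/-- The way back from the localization to numerators in lowest terms. -/
theorem pow_dvd_num (hP : Prime P) (hf : LocDvd P e f) : P ^ e ∣ f.num := by
  obtain ⟨a, b, hb, h⟩ := hf
  have hd : algebraMap ℚ[X] (RatFunc ℚ) f.denom ≠ 0 := by simpa using f.denom_ne_zero
  have h1 : f.num * b = P ^ e * a * f.denom := by
    apply IsFractionRing.injective ℚ[X] (RatFunc ℚ)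
    rw [map_mul, map_mul (algebraMap ℚ[X] (RatFunc ℚ)) (P ^ e * a), ← h]
    nth_rewrite 2 [← RatFunc.num_div_denom f]
    field_simp
  exact hP.pow_dvd_of_dvd_mul_right e hb ⟨a * f.denom, by rw [h1, mul_assoc]⟩

end LocDvd

/-! ### Powers of the indeterminate modulo a cyclotomic polynomial. -/

section Cyclotomic

open Polynomial

variable {d : ℕ}

theorem cyclotomic_rat_prime (hd : 0 < d) : Prime (cyclotomic d ℚ) :=
  (cyclotomic.irreducible_rat hd).prime

theorem cyclotomic_dvd_one_sub_X_pow {m : ℕ} (h : d ∣ m) : cyclotomic d ℚ ∣ 1 - X ^ m := by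
  rw [← neg_sub, dvd_neg]
  refine (cyclotomic.dvd_X_pow_sub_one d ℚ).trans ?_
  obtain ⟨c, rfl⟩ := h
  simpa [pow_mul] using sub_dvd_pow_sub_pow (X ^ d : ℚ[X]) 1 c

theorem dvd_of_cyclotomic_dvd_one_sub_X_pow (hd : 0 < d) {m : ℕ}
    (h : cyclotomic d ℚ ∣ 1 - X ^ m) : d ∣ m := by
  have : NeZero d := ⟨hd.ne'⟩
  have : NeZero (d : ℂ) := ⟨by exact_mod_cast hd.ne'⟩
  have hz := Complex.isPrimitiveRoot_exp d hd.ne'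
  set z := Complex.exp (2 * Real.pi * Complex.I / d)
  have h0 : aeval z (cyclotomic d ℚ) = 0 := by
    rw [aeval_def, eval₂_eq_eval_map, map_cyclotomic]
    exact isRoot_cyclotomic_iff.2 hz
  have h1 : aeval z (1 - X ^ m : ℚ[X]) = 0 := aeval_eq_zero_of_dvd_aeval_eq_zero h h0
  refine hz.dvd_of_pow_eq_one m ?_
  simp only [map_sub, map_one, map_pow, aeval_X] at h1
  exact (sub_eq_zero.1 h1).symm

/-- Modulo Φ_d the element X has odd order d, so -1 is not one of its powers; otherwise Φ_d would
divide the unit 2. -/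
theorem not_cyclotomic_dvd_one_add_X_pow (hd : Odd d) (hd1 : 1 < d) (m : ℕ) :
    ¬ cyclotomic d ℚ ∣ 1 + X ^ m := by
  intro h
  have hP := cyclotomic_rat_prime (zero_lt_one.trans hd1)
  have h1 : cyclotomic d ℚ ∣ 1 - X ^ (2 * m) := by
    convert h.mul_right (1 - X ^ m) using 1
    ring
  have h2 : d ∣ m := Nat.Coprime.dvd_of_dvd_mul_left hd.coprime_two_right
    (dvd_of_cyclotomic_dvd_one_sub_X_pow (zero_lt_one.trans hd1) h1)
  have h3 := dvd_add h (cyclotomic_dvd_one_sub_X_pow h2)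
  have h4 : (1 + X ^ m + (1 - X ^ m) : ℚ[X]) = C 2 := by
    rw [show (C 2 : ℚ[X]) = 2 from rfl]; ring
  rw [h4] at h3
  exact hP.not_isUnit (isUnit_of_dvd_unit h3 (isUnit_C.2 (by norm_num)))

theorem cyclotomic_dvd_X_pow_sub_X_pow {a b : ℕ} (h : a % d = b % d) :
    cyclotomic d ℚ ∣ X ^ a - X ^ b := by
  wlog hab : b ≤ a generalizing a b
  · rw [← neg_sub, dvd_neg]
    exact this h.symm (by omega)
  have h1 : d ∣ a - b := (Nat.modEq_iff_dvd' hab).1 h.symm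
  have h2 : (X ^ a - X ^ b : ℚ[X]) = -(X ^ b * (1 - X ^ (a - b))) := by
    rw [mul_sub, mul_one, ← pow_add, Nat.add_sub_cancel' hab, neg_sub]
  rw [h2, dvd_neg]
  exact (cyclotomic_dvd_one_sub_X_pow h1).mul_left _

end Cyclotomic

theorem map_qShifted {R S : Type*} [CommRing R] [CommRing S] (f : R →+* S) (a p : R) (k : ℕ) :
    f (qShifted a p k) = qShifted (f a) (f p) k := by
  simp [qShifted, map_prod]

theorem map_qInteger {R S : Type*} [CommRing R] [CommRing S] (f : R →+* S) (p : R) (k : ℕ) :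
    f (qInteger p k) = qInteger (f p) k := by
  simp [qInteger, map_sum]

/-! ### Integrality and vanishing of the terms at Φ_d. -/

section Local

open Polynomial

variable {d : ℕ}

theorem ratFunc_X_pow_ne_one (m : ℕ) (hm : 0 < m) : (RatFunc.X : RatFunc ℚ) ^ m ≠ 1 := by
  rw [← RatFunc.algebraMap_X, ← map_pow, ← map_one (algebraMap ℚ[X] (RatFunc ℚ))]
  intro h
  have h1 := IsFractionRing.injective ℚ[X] (RatFunc ℚ) h
  have h2 := congrArg natDegree h1
  simp at h2
  omega

theorem X_pow_ne_one (m : ℕ) (hm : 0 < m) : (X : ℚ[X]) ^ m ≠ 1 := by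
  intro h
  have h2 := congrArg natDegree h
  simp at h2
  omega

/-- The case s = 1 covers (q;q^2)_k / (q^2;q^2)_k and s = 2 covers (q^2;q^4)_k / (q^4;q^4)_k, for
every k, even when Φ_d divides the denominator. -/
theorem locDvd_qShifted_div (hd : Odd d) (hd1 : 1 < d) {s : ℕ} (hs : 0 < s) (k : ℕ) :
    LocDvd (cyclotomic d ℚ) 0 (qShifted (RatFunc.X ^ s) ((RatFunc.X ^ s) ^ 2) k /
      qShifted ((RatFunc.X ^ s) ^ 2) ((RatFunc.X ^ s) ^ 2) k) := by
  have hP := cyclotomic_rat_prime (zero_lt_one.trans hd1)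
  have hp : ∀ m, 0 < m → ((X : ℚ[X]) ^ s) ^ m ≠ 1 := fun m hm => by
    rw [← pow_mul]
    exact X_pow_ne_one _ (Nat.mul_pos hs hm)
  obtain ⟨b, hb⟩ := exists_qShifted_mul_sq_eq hp k
  have h0 : qShifted (((X : ℚ[X]) ^ s) ^ 2) ((X ^ s) ^ 2) k ≠ 0 := by
    refine Finset.prod_ne_zero_iff.2 fun i _ => sub_ne_zero.2 ?_
    convert (hp (2 + 2 * i) (by omega)).symm using 1
    ring
  have hX : (RatFunc.X ^ s : RatFunc ℚ) = algebraMap ℚ[X] (RatFunc ℚ) (X ^ s) := by simp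
  refine ⟨b, qShifted (-X ^ s) (X ^ s) k ^ 2, fun h => ?_, ?_⟩
  · obtain ⟨i, _, hi⟩ := (hP.dvd_finsetProd_iff _).1 (hP.dvd_of_dvd_pow h)
    refine not_cyclotomic_dvd_one_add_X_pow hd hd1 (s + s * i) ?_
    convert hi using 1
    ring
  · rw [hX, ← map_pow, ← map_qShifted, ← map_qShifted, div_mul_eq_mul_div, ← map_mul, hb,
      div_eq_iff (by simpa using h0), pow_zero, one_mul, map_mul]

theorem locDvd_neg_one_pow {P : ℚ[X]} (hP : Prime P) (k : ℕ) : LocDvd P 0 ((-1) ^ k) := by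
  simpa using LocDvd.polynomial hP ((-1) ^ k)

theorem locDvd_X_pow {P : ℚ[X]} (hP : Prime P) (k : ℕ) : LocDvd P 0 (RatFunc.X ^ k) := by
  simpa using LocDvd.polynomial hP (X ^ k)

theorem locDvd_qInteger {P : ℚ[X]} (hP : Prime P) (k : ℕ) :
    LocDvd P 0 (qInteger RatFunc.X k) := by
  simpa [map_qInteger] using LocDvd.polynomial hP (qInteger X k)

theorem locDvd_wellPoisedWeight_of (hd : Odd d) (hd1 : 1 < d) {e k : ℕ}
    (h : LocDvd (cyclotomic d ℚ) e
      (qShifted RatFunc.X (RatFunc.X ^ 2) k / qShifted (RatFunc.X ^ 2) (RatFunc.X ^ 2) k)) :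
    LocDvd (cyclotomic d ℚ) (4 * e) (wellPoisedWeight RatFunc.X 1 k) := by
  have hP := cyclotomic_rat_prime (zero_lt_one.trans hd1)
  rw [wellPoisedWeight_one]
  refine (LocDvd.mul_left hP (locDvd_neg_one_pow hP k) ?_).mul_right hP (locDvd_X_pow hP k)
  refine (h.pow hP 4).mul_right hP ?_
  simpa [← pow_mul] using locDvd_qShifted_div hd hd1 two_pos k

theorem locDvd_wellPoisedWeight (hd : Odd d) (hd1 : 1 < d) (k : ℕ) :
    LocDvd (cyclotomic d ℚ) 0 (wellPoisedWeight RatFunc.X 1 k) := by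
  have h := locDvd_qShifted_div hd hd1 one_pos k
  rw [pow_one] at h
  exact (locDvd_wellPoisedWeight_of hd hd1 h).mono (Nat.zero_le _)

theorem locDvd_wellPoisedTerm (hd : Odd d) (hd1 : 1 < d) (k : ℕ) :
    LocDvd (cyclotomic d ℚ) 0 (wellPoisedTerm RatFunc.X 1 k) :=
  have hP := cyclotomic_rat_prime (zero_lt_one.trans hd1)
  LocDvd.mul_left hP (locDvd_qInteger hP _) (locDvd_wellPoisedWeight hd hd1 k)

/-- The terms in the upper half of a period vanish modulo `Φ_d ^ 3`. -/
theorem locDvd_wellPoisedTerm_of_lt (hd : Odd d) (hd1 : 1 < d) {k : ℕ} (hk : d < 2 * k)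
    (hkd : k < d) : LocDvd (cyclotomic d ℚ) 3 (wellPoisedTerm RatFunc.X 1 k) := by
  have hP := cyclotomic_rat_prime (zero_lt_one.trans hd1)
  refine LocDvd.mul_left hP (locDvd_qInteger hP _) ?_
  -- One factor Φ_d in (q;q^2)_k becomes Φ_d^4 in the weight; the third power suffices.
  refine LocDvd.mono (locDvd_wellPoisedWeight_of hd hd1 (e := 1) ?_) (by norm_num)
  rw [← RatFunc.algebraMap_X, ← map_pow, ← map_qShifted, ← map_qShifted]
  refine LocDvd.div (LocDvd.of_dvd hP ?_) hP fun h => ?_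
  · obtain ⟨m, hm⟩ := hd
    rw [pow_one]
    -- For d = 2m + 1 the factor of index m is 1 - X^d.
    refine dvd_trans ?_ (Finset.dvd_prod_of_mem _ (Finset.mem_range.2 (show m < k by omega)))
    convert cyclotomic_dvd_one_sub_X_pow (dvd_refl d) using 2
    rw [hm]
    ring
  · obtain ⟨i, hi, h⟩ := (hP.dvd_finsetProd_iff _).1 h
    rw [Finset.mem_range] at hi
    have h1 : d ∣ 2 * (i + 1) := dvd_of_cyclotomic_dvd_one_sub_X_pow (zero_lt_one.trans hd1) (by
      convert h using 1; ring)
    have := Nat.le_of_dvd (by omega) (Nat.Coprime.dvd_of_dvd_mul_left hd.coprime_two_right h1)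
    omega

/-! ### Term ratios modulo Φ_d: periodicity and change of parameter. -/

/-- The numerator of `wellPoisedRatio` at `x = X ^ n`, `y = X ^ (2 * i)`. -/
noncomputable def ratioNum (n i : ℕ) : ℚ[X] :=
  -X * ((1 - X ^ (2 * i + 1) * X ^ n) * (X ^ n - X ^ (2 * i + 1)) * (1 - X ^ (2 * i + 1)) ^ 2 *
    (1 - X ^ (4 * i + 2)))

/-- The denominator of `wellPoisedRatio` at `x = X ^ n`, `y = X ^ (2 * i)`. -/
noncomputable def ratioDen (n i : ℕ) : ℚ[X] :=
  (1 - X ^ (2 * i + 2) * X ^ n) * (X ^ n - X ^ (2 * i + 2)) * (1 - X ^ (2 * i + 2)) ^ 2 *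
    (1 - X ^ (4 * i + 4))

theorem wellPoisedRatio_eq_div (n i : ℕ) :
    wellPoisedRatio (RatFunc.X : RatFunc ℚ) (RatFunc.X ^ n) ((RatFunc.X ^ i) ^ 2) =
      algebraMap ℚ[X] (RatFunc ℚ) (ratioNum n i) / algebraMap ℚ[X] (RatFunc ℚ) (ratioDen n i) := by
  simp only [wellPoisedRatio, ratioNum, ratioDen, map_mul, map_sub, map_neg, map_pow, map_one,
    RatFunc.algebraMap_X]
  congr 1 <;> ring

theorem not_dvd_ratioDen (hd : Odd d) {i : ℕ} (hi : i + 1 < d) :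
    ¬ cyclotomic d ℚ ∣ ratioDen 0 i := by
  have hP := cyclotomic_rat_prime (d := d) (by omega)
  have h1 : ¬ cyclotomic d ℚ ∣ 1 - X ^ (2 * (i + 1)) := fun h => by
    have := Nat.le_of_dvd (by omega) (Nat.Coprime.dvd_of_dvd_mul_left hd.coprime_two_right
      (dvd_of_cyclotomic_dvd_one_sub_X_pow (by omega) h))
    omega
  have h2 : ¬ cyclotomic d ℚ ∣ 1 - X ^ (2 * (2 * (i + 1))) := fun h => by
    have := Nat.le_of_dvd (by omega) (Nat.Coprime.dvd_of_dvd_mul_left hd.coprime_two_right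
      (Nat.Coprime.dvd_of_dvd_mul_left hd.coprime_two_right
        (dvd_of_cyclotomic_dvd_one_sub_X_pow (by omega) h)))
    omega
  intro h
  rw [ratioDen, pow_zero, mul_one, show 2 * i + 2 = 2 * (i + 1) by ring,
    show 4 * i + 4 = 2 * (2 * (i + 1)) by ring] at h
  rcases hP.dvd_or_dvd h with h | h
  · rcases hP.dvd_or_dvd h with h | h
    · rcases hP.dvd_or_dvd h with h | h <;> exact h1 h
    · exact h1 (hP.dvd_of_dvd_pow h)
  · exact h2 h

theorem locDvd_wellPoisedRatio (hd : Odd d) {i : ℕ} (hi : i + 1 < d) :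
    LocDvd (cyclotomic d ℚ) 0
      (wellPoisedRatio (RatFunc.X : RatFunc ℚ) 1 ((RatFunc.X ^ i) ^ 2)) := by
  have hP := cyclotomic_rat_prime (d := d) (by omega)
  rw [← pow_zero RatFunc.X, wellPoisedRatio_eq_div]
  exact (LocDvd.polynomial hP _).div hP (not_dvd_ratioDen hd hi)

theorem mk_X_pow_eq {a b : ℕ} (h : a % d = b % d) :
    Ideal.Quotient.mk (Ideal.span {cyclotomic d ℚ}) X ^ a =
      Ideal.Quotient.mk (Ideal.span {cyclotomic d ℚ}) X ^ b := by
  rw [← map_pow, ← map_pow, Ideal.Quotient.eq, Ideal.mem_span_singleton]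
  exact cyclotomic_dvd_X_pow_sub_X_pow h

/-- X^d = 1 modulo Φ_d, so numerator and denominator depend on the index modulo d only. The index i
= d - 1 is left out since the denominator vanishes there; this is why the later congruences compare
terms within one block and keep the factor at its start. -/
theorem locDvd_wellPoisedRatio_periodic (hd : Odd d) {i : ℕ} (hi : i + 1 < d) (u : ℕ) :
    LocDvd (cyclotomic d ℚ) 1
      (wellPoisedRatio (RatFunc.X : RatFunc ℚ) 1 ((RatFunc.X ^ (u * d + i)) ^ 2) -
        wellPoisedRatio (RatFunc.X : RatFunc ℚ) 1 ((RatFunc.X ^ i) ^ 2)) := by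
  have hP := cyclotomic_rat_prime (d := d) (by omega)
  have hm : ∀ a b, (a * (u * d + i) + b) % d = (a * i + b) % d := fun a b => by
    rw [show a * (u * d + i) + b = a * i + b + d * (a * u) by ring, Nat.add_mul_mod_self_left]
  rw [← pow_zero RatFunc.X, wellPoisedRatio_eq_div, wellPoisedRatio_eq_div]
  refine LocDvd.div_sub_div hP one_ne_zero ?_ ?_ (not_dvd_ratioDen hd hi)
  · rw [pow_one, ← Ideal.mem_span_singleton, ← Ideal.Quotient.eq]
    simp only [ratioNum, map_mul, map_sub, map_neg, map_pow, map_one]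
    rw [mk_X_pow_eq (hm 2 1), mk_X_pow_eq (hm 4 2)]
  · rw [pow_one, ← Ideal.mem_span_singleton, ← Ideal.Quotient.eq]
    simp only [ratioDen, map_mul, map_sub, map_pow, map_one]
    rw [mk_X_pow_eq (hm 2 2), mk_X_pow_eq (hm 4 4)]

/-- The symmetry x ↔ 1/x appears as (1 - ax)(x - a) = x(1 - a)^2 - a(1 - x)^2. The fraction at x = 1
is expanded by X^d so that this identity compares numerators with numerators and denominators with
denominators. -/
theorem locDvd_wellPoisedRatio_param (hd : Odd d) {i : ℕ} (hi : i + 1 < d) :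
    LocDvd (cyclotomic d ℚ) 2
      (wellPoisedRatio (RatFunc.X : RatFunc ℚ) (RatFunc.X ^ d) ((RatFunc.X ^ i) ^ 2) -
        wellPoisedRatio (RatFunc.X : RatFunc ℚ) 1 ((RatFunc.X ^ i) ^ 2)) := by
  have hP := cyclotomic_rat_prime (d := d) (by omega)
  have hsq : cyclotomic d ℚ ^ 2 ∣ (1 - X ^ d) ^ 2 :=
    pow_dvd_pow_of_dvd (cyclotomic_dvd_one_sub_X_pow dvd_rfl) 2
  have hX : algebraMap ℚ[X] (RatFunc ℚ) (X ^ d) ≠ 0 := by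
    simp [RatFunc.X_ne_zero]
  have hXd : ¬ cyclotomic d ℚ ∣ X ^ d := fun h => by
    have := dvd_add (cyclotomic_dvd_one_sub_X_pow (d := d) dvd_rfl) h
    rw [sub_add_cancel] at this
    exact hP.not_isUnit (isUnit_of_dvd_one this)
  rw [wellPoisedRatio_eq_div, ← pow_zero RatFunc.X, wellPoisedRatio_eq_div,
    ← mul_div_mul_left (algebraMap ℚ[X] (RatFunc ℚ) (ratioNum 0 i)) _ hX, ← map_mul, ← map_mul]
  refine LocDvd.div_sub_div hP two_ne_zero ?_ ?_
    fun h => (hP.dvd_or_dvd h).elim hXd (not_dvd_ratioDen hd hi)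
  · refine hsq.trans ⟨X * X ^ (2 * i + 1) * ((1 - X ^ (2 * i + 1)) ^ 2 * (1 - X ^ (4 * i + 2))), ?_⟩
    rw [ratioNum, ratioNum]
    ring
  · refine hsq.trans ⟨-X ^ (2 * i + 2) * ((1 - X ^ (2 * i + 2)) ^ 2 * (1 - X ^ (4 * i + 4))), ?_⟩
    rw [ratioDen, ratioDen]
    ring

end Local

theorem wellPoisedWeight_succ {F : Type*} [Field F] (q x : F) (k : ℕ) :
    wellPoisedWeight q x (k + 1) = wellPoisedWeight q x k * wellPoisedRatio q x ((q ^ k) ^ 2) :=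
  Finset.prod_range_succ _ _

section Local

open Polynomial

variable {d : ℕ}

theorem locDvd_wellPoisedWeight_param (hd : Odd d) (hd1 : 1 < d) {k : ℕ} (hk : k < d) :
    LocDvd (cyclotomic d ℚ) 2
      (wellPoisedWeight (RatFunc.X : RatFunc ℚ) (RatFunc.X ^ d) k -
        wellPoisedWeight (RatFunc.X : RatFunc ℚ) 1 k) := by
  have hP := cyclotomic_rat_prime (d := d) (by omega)
  induction k with
  | zero => simpa [wellPoisedWeight] using LocDvd.zero hP
  | succ k ih =>
    have hr := locDvd_wellPoisedRatio_param hd hk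
    rw [wellPoisedWeight_succ, wellPoisedWeight_succ]
    refine LocDvd.mul_sub_mul hP (ih (by omega)) hr (locDvd_wellPoisedWeight hd hd1 k) ?_
    simpa using (hr.mono (Nat.zero_le _)).add hP (locDvd_wellPoisedRatio hd hk)

theorem locDvd_wellPoisedTerm_param (hd : Odd d) (hd1 : 1 < d) {k : ℕ} (hk : k < d) :
    LocDvd (cyclotomic d ℚ) 2
      (wellPoisedTerm (RatFunc.X : RatFunc ℚ) (RatFunc.X ^ d) k -
        wellPoisedTerm (RatFunc.X : RatFunc ℚ) 1 k) := by
  have hP := cyclotomic_rat_prime (d := d) (by omega)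
  rw [wellPoisedTerm, wellPoisedTerm, ← mul_sub]
  exact LocDvd.mul_left hP (locDvd_qInteger hP _) (locDvd_wellPoisedWeight_param hd hd1 hk)

theorem locDvd_wellPoisedWeight_periodic (hd : Odd d) (hd1 : 1 < d) (u : ℕ) {r : ℕ} (hr : r < d) :
    LocDvd (cyclotomic d ℚ) 1
      (wellPoisedWeight (RatFunc.X : RatFunc ℚ) 1 (u * d + r) -
        wellPoisedWeight (RatFunc.X : RatFunc ℚ) 1 (u * d) *
          wellPoisedWeight (RatFunc.X : RatFunc ℚ) 1 r) := by
  have hP := cyclotomic_rat_prime (d := d) (by omega)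
  induction r with
  | zero => simpa [wellPoisedWeight] using LocDvd.zero hP
  | succ r ih =>
    have h := locDvd_wellPoisedRatio_periodic hd hr u
    rw [← add_assoc, wellPoisedWeight_succ, wellPoisedWeight_succ, ← mul_assoc]
    refine LocDvd.mul_sub_mul hP (ih (by omega)) h (LocDvd.mul_left hP
      (locDvd_wellPoisedWeight hd hd1 _) (locDvd_wellPoisedWeight hd hd1 r)) ?_
    simpa using (h.mono (Nat.zero_le _)).add hP (locDvd_wellPoisedRatio hd hr)

theorem locDvd_qInteger_periodic (hd : 1 < d) (u r : ℕ) :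
    LocDvd (cyclotomic d ℚ) 1
      (qInteger (RatFunc.X : RatFunc ℚ) (u * d + r) - qInteger RatFunc.X r) := by
  have hP := cyclotomic_rat_prime (zero_lt_one.trans hd)
  rw [← RatFunc.algebraMap_X, ← map_qInteger, ← map_qInteger, ← map_sub]
  refine LocDvd.of_dvd hP ?_
  have h1 : qInteger (X : ℚ[X]) (u * d + r) - qInteger X r =
      (∑ i ∈ Finset.range (u * d), X ^ i) - (1 - X ^ (u * d)) * qInteger X r := by
    simp only [qInteger, Finset.sum_range_add, pow_add, ← Finset.mul_sum]
    ring
  rw [h1, pow_one]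
  exact dvd_sub (cyclotomic_dvd_geom_sum_of_dvd ℚ (dvd_mul_left d u) hd.ne')
    ((cyclotomic_dvd_one_sub_X_pow (dvd_mul_left d u)).mul_right _)

theorem locDvd_wellPoisedTerm_periodic (hd : Odd d) (hd1 : 1 < d) (u : ℕ) {r : ℕ} (hr : r < d) :
    LocDvd (cyclotomic d ℚ) 1
      (wellPoisedTerm (RatFunc.X : RatFunc ℚ) 1 (u * d + r) -
        wellPoisedTerm (RatFunc.X : RatFunc ℚ) 1 (u * d) *
          wellPoisedTerm (RatFunc.X : RatFunc ℚ) 1 r) := by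
  have hP := cyclotomic_rat_prime (d := d) (by omega)
  -- The extra factor [4ud + 1] is 1 modulo Φ_d; it completes the weight at ud to a term.
  have h1 : LocDvd (cyclotomic d ℚ) 1 (qInteger (RatFunc.X : RatFunc ℚ) (4 * (u * d + r) + 1) -
      qInteger RatFunc.X (4 * (u * d) + 1) * qInteger RatFunc.X (4 * r + 1)) := by
    have h2 := locDvd_qInteger_periodic (d := d) (by omega) (4 * u) (4 * r + 1)
    have h3 := LocDvd.mul_right hP (locDvd_qInteger_periodic (d := d) (by omega) (4 * u) 1)
      (locDvd_qInteger hP (4 * r + 1))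
    have h4 : qInteger (RatFunc.X : RatFunc ℚ) 1 = 1 := by simp [qInteger]
    convert h2.sub hP h3 using 1
    rw [h4, show 4 * (u * d + r) + 1 = 4 * u * d + (4 * r + 1) by ring,
      show 4 * (u * d) + 1 = 4 * u * d + 1 by ring]
    ring
  rw [wellPoisedTerm, wellPoisedTerm, wellPoisedTerm, mul_mul_mul_comm]
  exact LocDvd.mul_sub_mul hP h1 (locDvd_wellPoisedWeight_periodic hd hd1 u hr)
    (LocDvd.mul_left hP (locDvd_qInteger hP _) (locDvd_qInteger hP _))
    (locDvd_wellPoisedWeight hd hd1 _)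

/-! ### Congruences for the single sums. -/

/-- The exact value of the terminating series with parameter `q ^ n`. -/
noncomputable def terminatingValue (n : ℕ) : RatFunc ℚ :=
  if n % 4 = 1 then
    qInteger RatFunc.X n * (qShifted (RatFunc.X ^ 2) (RatFunc.X ^ 4) ((n - 1) / 4) /
      qShifted (RatFunc.X ^ 4) (RatFunc.X ^ 4) ((n - 1) / 4)) ^ 2
  else 0

theorem sum_wellPoisedTerm_eq_terminatingValue {n K : ℕ} (hn : Odd n) (hK : n < 2 * K) :
    ∑ k ∈ Finset.range K, wellPoisedTerm (RatFunc.X : RatFunc ℚ) (RatFunc.X ^ n) k =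
      terminatingValue n := by
  have h0 : (RatFunc.X : RatFunc ℚ) ≠ 0 := RatFunc.X_ne_zero
  rcases Nat.odd_mod_four_iff.1 (Nat.odd_iff.1 hn) with h | h
  · obtain ⟨m, rfl⟩ : ∃ m, n = 4 * m + 1 := ⟨n / 4, by omega⟩
    rw [terminatingValue, if_pos h,
      sum_wellPoisedTerm_one_mod_four ratFunc_X_pow_ne_one h0 m K (by omega),
      show (4 * m + 1 - 1) / 4 = m by omega]
  · obtain ⟨m, rfl⟩ : ∃ m, n = 4 * m + 3 := ⟨n / 4, by omega⟩
    rw [terminatingValue, if_neg (by omega),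
      sum_wellPoisedTerm_three_mod_four ratFunc_X_pow_ne_one h0 m K (by omega)]

theorem locDvd_terminatingValue (hd : Odd d) (hd1 : 1 < d) {n : ℕ} (hdn : d ∣ n) :
    LocDvd (cyclotomic d ℚ) 1 (terminatingValue n) := by
  have hP := cyclotomic_rat_prime (d := d) (by omega)
  rw [terminatingValue]
  split_ifs
  · refine LocDvd.mul_right hP ?_ ?_
    · rw [← RatFunc.algebraMap_X, ← map_qInteger]
      refine LocDvd.of_dvd hP ?_
      rw [pow_one]
      exact cyclotomic_dvd_geom_sum_of_dvd ℚ hdn hd1.ne'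
    · have := locDvd_qShifted_div hd hd1 two_pos ((n - 1) / 4)
      rw [← pow_mul] at this
      exact this.pow hP 2
  · exact LocDvd.zero hP

/-- The supercongruence modulo `Φ_d ^ 2` for the single sum. -/
theorem locDvd_sum_sub_terminatingValue (hd : Odd d) (hd1 : 1 < d) {K : ℕ} (hK : d < 2 * K)
    (hKd : K ≤ d) : LocDvd (cyclotomic d ℚ) 2
      (∑ k ∈ Finset.range K, wellPoisedTerm (RatFunc.X : RatFunc ℚ) 1 k - terminatingValue d) := by
  have hP := cyclotomic_rat_prime (d := d) (by omega)
  rw [← sum_wellPoisedTerm_eq_terminatingValue hd hK, ← Finset.sum_sub_distrib]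
  refine LocDvd.sum hP _ fun k hk => ?_
  rw [← neg_sub]
  exact (locDvd_wellPoisedTerm_param hd hd1 ((Finset.mem_range.1 hk).trans_le hKd)).neg hP

theorem locDvd_sum_wellPoisedTerm (hd : Odd d) (hd1 : 1 < d) {K : ℕ} (hK : d < 2 * K)
    (hKd : K ≤ d) : LocDvd (cyclotomic d ℚ) 1
      (∑ k ∈ Finset.range K, wellPoisedTerm (RatFunc.X : RatFunc ℚ) 1 k) := by
  have hP := cyclotomic_rat_prime (d := d) (by omega)
  simpa using ((locDvd_sum_sub_terminatingValue hd hd1 hK hKd).mono one_le_two).add hP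
    (locDvd_terminatingValue hd hd1 dvd_rfl)

/-- Modulo Φ_d the block is its first term times the initial sum of the same length. Incomplete
blocks longer than d/2 are included because the truncated square cuts its inner sums inside a
period. -/
theorem locDvd_sum_block (hd : Odd d) (hd1 : 1 < d) (u : ℕ) {s : ℕ} (hs : d < 2 * s)
    (hsd : s ≤ d) : LocDvd (cyclotomic d ℚ) 1
      (∑ r ∈ Finset.range s, wellPoisedTerm (RatFunc.X : RatFunc ℚ) 1 (u * d + r)) := by
  have hP := cyclotomic_rat_prime (d := d) (by omega)
  have h1 : LocDvd (cyclotomic d ℚ) 1 (∑ r ∈ Finset.range s,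
      (wellPoisedTerm (RatFunc.X : RatFunc ℚ) 1 (u * d + r) -
        wellPoisedTerm (RatFunc.X : RatFunc ℚ) 1 (u * d) *
          wellPoisedTerm (RatFunc.X : RatFunc ℚ) 1 r)) :=
    LocDvd.sum hP _ fun r hr =>
      locDvd_wellPoisedTerm_periodic hd hd1 u ((Finset.mem_range.1 hr).trans_le hsd)
  have h2 := LocDvd.mul_left hP (locDvd_wellPoisedTerm hd hd1 (u * d))
    (locDvd_sum_wellPoisedTerm hd hd1 hs hsd)
  rw [Finset.mul_sum] at h2
  simpa using h1.add hP h2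

theorem locDvd_sum_periods (hd : Odd d) (hd1 : 1 < d) (u : ℕ) : LocDvd (cyclotomic d ℚ) 1
      (∑ r ∈ Finset.range (u * d), wellPoisedTerm (RatFunc.X : RatFunc ℚ) 1 r) := by
  have hP := cyclotomic_rat_prime (d := d) (by omega)
  induction u with
  | zero => simpa using LocDvd.zero hP
  | succ u ih =>
    rw [Nat.succ_mul, Finset.sum_range_add]
    exact ih.add hP (locDvd_sum_block hd hd1 u (by omega) le_rfl)

theorem locDvd_sum_range_add (hd : Odd d) (hd1 : 1 < d) (u : ℕ) {s : ℕ} (hs : d < 2 * s)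
    (hsd : s ≤ d) : LocDvd (cyclotomic d ℚ) 1
      (∑ r ∈ Finset.range (u * d + s), wellPoisedTerm (RatFunc.X : RatFunc ℚ) 1 r) := by
  have hP := cyclotomic_rat_prime (d := d) (by omega)
  rw [Finset.sum_range_add]
  exact (locDvd_sum_periods hd hd1 u).add hP (locDvd_sum_block hd hd1 u hs hsd)

/-! ### The truncated Cauchy square. -/

/-- The truncated Cauchy square of the series `wellPoisedTerm q 1`. -/
noncomputable def truncatedSquare (n : ℕ) : RatFunc ℚ :=
  ∑ j ∈ Finset.range n, ∑ i ∈ Finset.range (n - j),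
    wellPoisedTerm RatFunc.X 1 j * wellPoisedTerm RatFunc.X 1 i

/-- Every row vanishes: if j mod d exceeds d/2 the outer term is zero modulo Φ_d, and otherwise the
inner sum ends with a block of length d - (j mod d) > d/2. -/
theorem locDvd_truncatedSquare (hd : Odd d) (hd1 : 1 < d) {n : ℕ} (hdn : d ∣ n) :
    LocDvd (cyclotomic d ℚ) 1 (truncatedSquare n) := by
  have hP := cyclotomic_rat_prime (d := d) (by omega)
  refine LocDvd.sum hP _ fun j hj => ?_
  rw [← Finset.mul_sum]
  obtain ⟨c, rfl⟩ := hdn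
  have hj' : j < d * c := Finset.mem_range.1 hj
  have hjd : d * (j / d) + j % d = j := Nat.div_add_mod j d
  have hlt : j % d < d := Nat.mod_lt _ (by omega)
  have hjc : j / d < c := Nat.div_lt_of_lt_mul hj'
  obtain ⟨e, rfl⟩ := Nat.exists_eq_add_of_lt hjc
  have hsub : d * (j / d + e + 1) - j = e * d + (d - j % d) := by
    have : d * (j / d + e + 1) = d * (j / d) + e * d + d := by ring
    omega
  rw [hsub]
  by_cases h : d < 2 * (j % d)
  · refine LocDvd.mul_right hP ?_ (LocDvd.sum hP _ fun i _ => locDvd_wellPoisedTerm hd hd1 i)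
    have h1 := locDvd_wellPoisedTerm_periodic hd hd1 (j / d) hlt
    have h2 := LocDvd.mul_left hP (locDvd_wellPoisedTerm hd hd1 (j / d * d))
      ((locDvd_wellPoisedTerm_of_lt hd hd1 h hlt).mono (by norm_num : 1 ≤ 3))
    have h3 := h1.add hP h2
    rwa [sub_add_cancel, mul_comm (j / d) d, hjd] at h3
  · refine LocDvd.mul_left hP (locDvd_wellPoisedTerm hd hd1 j) ?_
    have hne : 2 * (j % d) ≠ d := by
      obtain ⟨m, hm⟩ := hd
      omega
    exact locDvd_sum_range_add hd hd1 e (by omega) (by omega)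

theorem locDvd_truncatedSquare_sub (hd : Odd d) (hd1 : 1 < d) :
    LocDvd (cyclotomic d ℚ) 3 (truncatedSquare d - terminatingValue d ^ 2) := by
  have hP := cyclotomic_rat_prime (d := d) (by omega)
  obtain ⟨e, he⟩ := id hd
  set A := ∑ k ∈ Finset.range (e + 1), wellPoisedTerm (RatFunc.X : RatFunc ℚ) 1 k with hA
  have h1 : LocDvd (cyclotomic d ℚ) 3 (truncatedSquare d - A * A) := by
    rw [truncatedSquare]
    have hr : Finset.range d = Finset.range (e + 1 + e) := by congr 1; omega
    rw [hr, Finset.sum_range_add, add_sub_right_comm, hA, Finset.sum_mul, ← hA,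
      ← Finset.sum_sub_distrib]
    refine LocDvd.add hP (LocDvd.sum hP _ fun j hj => ?_) (LocDvd.sum hP _ fun j hj => ?_)
    · rw [Finset.mem_range] at hj
      -- With d = 2e + 1 and j ≤ e, the inner sum is A plus terms from the upper half of the period.
      rw [← Finset.mul_sum, ← mul_sub, show d - j = e + 1 + (e - j) by omega,
        Finset.sum_range_add, add_sub_cancel_left]
      refine LocDvd.mul_left hP (locDvd_wellPoisedTerm hd hd1 j) (LocDvd.sum hP _ fun i hi => ?_)
      rw [Finset.mem_range] at hi
      exact locDvd_wellPoisedTerm_of_lt hd hd1 (by omega) (by omega)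
    · rw [Finset.mem_range] at hj
      rw [← Finset.mul_sum]
      exact LocDvd.mul_right hP (locDvd_wellPoisedTerm_of_lt hd hd1 (by omega) (by omega))
        (LocDvd.sum hP _ fun i _ => locDvd_wellPoisedTerm hd hd1 i)
  have h2 := locDvd_sum_sub_terminatingValue hd hd1 (K := e + 1) (by omega) (by omega)
  have h3 := (locDvd_sum_wellPoisedTerm hd hd1 (K := e + 1) (by omega) (by omega)).add hP
    (locDvd_terminatingValue hd hd1 dvd_rfl)
  -- A - V contributes Φ_d^2 and A + V one more Φ_d.
  have h4 := h1.add hP ((h2.mul hP h3).mono (by norm_num : 3 ≤ 2 + 1))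
  have h5 : truncatedSquare d - terminatingValue d ^ 2 = truncatedSquare d - A * A +
      (A - terminatingValue d) * (A + terminatingValue d) := by ring
  rw [h5]
  exact h4

end Local

/-! ### Assembling the modulus from its cyclotomic factors. -/

open Polynomial in
-- [n] is the product of Φ_d over the divisors d > 1 of n, so the modulus contains Φ_n three times
-- and every other Φ_d once, and these are pairwise coprime.
theorem qInteger_mul_cyclotomic_sq_dvd {n : ℕ} (hn : 1 < n) {p : ℚ[X]}
    (h1 : ∀ d, d ∣ n → 1 < d → cyclotomic d ℚ ∣ p) (h3 : cyclotomic n ℚ ^ 3 ∣ p) :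
    qInteger X n * cyclotomic n ℚ ^ 2 ∣ p := by
  have hmem : n ∈ n.divisors.erase 1 := by simp; omega
  have hprod : qInteger (X : ℚ[X]) n * cyclotomic n ℚ ^ 2 =
      ∏ d ∈ n.divisors.erase 1, cyclotomic d ℚ ^ (if d = n then 3 else 1) := by
    rw [qInteger, ← prod_cyclotomic_eq_geom_sum (by omega), ← Finset.mul_prod_erase _ _ hmem,
      ← Finset.mul_prod_erase _ _ hmem, if_pos rfl]
    have : ∏ x ∈ (n.divisors.erase 1).erase n, cyclotomic x ℚ ^ (if x = n then 3 else 1) =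
        ∏ x ∈ (n.divisors.erase 1).erase n, cyclotomic x ℚ :=
      Finset.prod_congr rfl fun x hx => by rw [if_neg (Finset.ne_of_mem_erase hx), pow_one]
    rw [this]
    ring
  rw [hprod]
  refine Finset.prod_dvd_of_coprime (fun a _ b _ hab => ?_) fun d hd => ?_
  · exact (cyclotomic.isCoprime_rat hab).pow
  · split_ifs with h
    · rw [h]
      exact h3
    · rw [pow_one]
      simp only [Finset.mem_erase, Nat.mem_divisors] at hd
      have : d ≠ 0 := by
        rintro rfl
        simp at hd
      exact h1 d hd.2.1 (by omega)

theorem theorem7 (n : ℕ) (hn : Odd n) :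
    RatFuncCongr
      (qInteger (Polynomial.X : Polynomial ℚ) n * Polynomial.cyclotomic n ℚ ^ 2)
      (∑ k ∈ Finset.range n, ∑ j ∈ Finset.range (k + 1), cTerm j * cTerm (k - j))
      (if n % 4 = 1 then
        qInteger (RatFunc.X : RatFunc ℚ) n ^ 2 *
          (qShifted (RatFunc.X ^ 2 : RatFunc ℚ) (RatFunc.X ^ 4) ((n - 1) / 4) ^ 4 /
            qShifted (RatFunc.X ^ 4 : RatFunc ℚ) (RatFunc.X ^ 4) ((n - 1) / 4) ^ 4)
      else 0) := by
  have hR : (if n % 4 = 1 then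
        qInteger (RatFunc.X : RatFunc ℚ) n ^ 2 *
          (qShifted (RatFunc.X ^ 2 : RatFunc ℚ) (RatFunc.X ^ 4) ((n - 1) / 4) ^ 4 /
            qShifted (RatFunc.X ^ 4 : RatFunc ℚ) (RatFunc.X ^ 4) ((n - 1) / 4) ^ 4)
      else 0) = terminatingValue n ^ 2 := by
    rw [terminatingValue]
    split_ifs <;> ring
  have hL : ∑ k ∈ Finset.range n, ∑ j ∈ Finset.range (k + 1), cTerm j * cTerm (k - j) =
      truncatedSquare n := by
    rw [Finset.sum_range_diag_flip n fun j i => cTerm j * cTerm i, truncatedSquare]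
    simp only [cTerm_eq_wellPoisedTerm]
  rw [RatFuncCongr, hR, hL]
  rcases (Nat.one_le_iff_ne_zero.2 hn.pos.ne').eq_or_lt with rfl | hn1
  -- For n = 1 the modulus is Φ_1^2, outside the range d > 1 of the local results, but both sides
  -- equal 1.
  · have : truncatedSquare 1 - terminatingValue 1 ^ 2 = 0 := by
      simp [truncatedSquare, terminatingValue, wellPoisedTerm, wellPoisedWeight, qInteger,
        qShifted]
    rw [this, RatFunc.num_zero]
    exact dvd_zero _
  refine qInteger_mul_cyclotomic_sq_dvd hn1 (fun d hdn hd1 => ?_) ?_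
  · have hd : Odd d := Odd.of_dvd_nat hn hdn
    have hP := cyclotomic_rat_prime (d := d) (by omega)
    rw [← pow_one (Polynomial.cyclotomic d ℚ)]
    refine LocDvd.pow_dvd_num hP ((locDvd_truncatedSquare hd hd1 hdn).sub hP ?_)
    exact ((locDvd_terminatingValue hd hd1 hdn).pow hP 2).mono (by norm_num)
  · exact LocDvd.pow_dvd_num (cyclotomic_rat_prime (by omega)) (locDvd_truncatedSquare_sub hn hn1)
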